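/- Let the pseudo-factorials $(\alpha_n)_{n\ge 0}$ be the integers defined by $\alpha_0=1$ and \[ \alpha_{n+1}=(-1)^{n+1}\sum_{k=0}^{n}\binom{n}{k}\alpha_k\,\alpha_{n-k}\qquad(n\ge 0). \] Let $\pi_3:=3\int_0^1\frac{dy}{(1-y^3)^{2/3}}$, let $r$ be the real number with $6r=2^{-1/3}\pi_3$, let $\rho:=2\sqrt3\,r$, and let $\zeta:=e^{i\pi/6}$. Then for every integer $n\ge 2$ the following double series converges absolutely, and \[ \alpha_n=-\frac{n!}{\rho^{\,n+1}}\sum_{\lambda,\mu\in\mathbb{Z}}\frac{\zeta^{8\lambda+4\mu}}{\left[\left(\lambda-\frac12\right)\zeta+\left(\mu-\frac12\right)\zeta^{-1}\right]^{n+1}}. \] -/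

import Mathlib

/-- The pseudo-factorials: `α 0 = 1` and
`α (n+1) = (-1)^(n+1) * ∑_{k=0}^{n} (n choose k) * α k * α (n-k)`. -/
def pseudoFactorial : ℕ → ℤ
  | 0 => 1
  | n + 1 => (-1) ^ (n + 1) *
      ∑ k : Fin (n + 1),
        (n.choose k : ℤ) * pseudoFactorial k * pseudoFactorial (n - k)
decreasing_by
  · exact k.isLt
  · exact Nat.lt_succ_of_le (Nat.sub_le n k)

theorem pseudoFactorial_zero : pseudoFactorial 0 = 1 := by
  rw [pseudoFactorial]

theorem pseudoFactorial_succ (n : ℕ) :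
    pseudoFactorial (n + 1) = (-1) ^ (n + 1) *
      ∑ k ∈ Finset.range (n + 1),
        (n.choose k : ℤ) * pseudoFactorial k * pseudoFactorial (n - k) := by
  rw [pseudoFactorial, Finset.sum_range]

/-- The period `π₃ = 3 ∫₀¹ dy / (1 - y³)^(2/3)`. -/
noncomputable def piThree : ℝ :=
  3 * ∫ y in (0 : ℝ)..1, 1 / (1 - y ^ 3) ^ (2 / 3 : ℝ)

/-- The number `r` defined by `6 r = π₃ 2^(-1/3)`. -/
noncomputable def hexR : ℝ := piThree * (2 : ℝ) ^ (-(1 / 3) : ℝ) / 6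

/-- `ρ = 2 √3 r`. -/
noncomputable def hexRho : ℝ := 2 * Real.sqrt 3 * hexR

/-- The primitive twelfth root of unity `ζ = e^{iπ/6}`. -/
noncomputable def hexZeta : ℂ := Complex.exp (Complex.I * (Real.pi : ℂ) / 6)

/-- The term of index `(l, m)` of the hexagonal lattice sum of exponent `n + 1`. -/
noncomputable def hexTerm (n : ℕ) (l m : ℤ) : ℂ :=
  hexZeta ^ (8 * l + 4 * m) /
    (((l : ℂ) - 1 / 2) * hexZeta + ((m : ℂ) - 1 / 2) * hexZeta⁻¹) ^ (n + 1)

/-!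
Let `ω = ζ ^ 4`. The Mittag-Leffler sum over the poles `p = (λ - 1/2) ζ + (μ - 1/2) ζ⁻¹` with
residues `ω ^ (2 λ + μ)` becomes, after adding an affine function, a meromorphic function `f` with
`f (z + ζ) = ω² f z` and `f (z + ζ⁻¹) = ω f z`. The rotation by `ω` about a pole forces the regular
part of `f` to vanish there, so that `deriv f z + f (-z)²` has no poles; being quasi-periodic with
nontrivial multipliers, it is zero.

Differentiating `deriv f z = -f (-z)²` at the origin reproduces the recurrence of the
pseudo-factorials: the `n`-th derivative of `f` at `0` is `f 0 ^ (n + 1) * α n`. On the other hand,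
for `n ≥ 2`, it is `-n!` times the lattice sum. Finally, on the real line `f x ^ 3 + f (-x) ^ 3` is
constant and `f` vanishes at `√3 / 6`; inverting `f` on `[-√3 / 6, √3 / 6]` evaluates the integral
defining `π₃` and gives `f 0 = ρ`.
-/

open Complex Filter Topology ComplexConjugate Metric
open scoped ContDiff

/-! ### Quasi-periodic functions -/

theorem deriv_add_const_of_quasiperiodic {𝕜 : Type*} [NontriviallyNormedField 𝕜] {f : 𝕜 → 𝕜}
    {l u : 𝕜} (h : ∀ z, f (z + l) = u * f z) (z : 𝕜) : deriv f (z + l) = u * deriv f z := by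
  rw [← deriv_comp_add_const, funext h, deriv_const_mul_field]

theorem isBounded_range_of_basis_periodic {ι E F : Type*} [Finite ι] [NormedAddCommGroup E]
    [NormedSpace ℝ E] [PseudoMetricSpace F] (b : Module.Basis ι ℝ E) {g : E → F}
    (hg : Continuous g) (hp : ∀ i, Function.Periodic g (b i)) :
    Bornology.IsBounded (Set.range g) := by
  have := Fintype.ofFinite ι
  have := b.finiteDimensional_of_finite
  have := FiniteDimensional.proper ℝ E
  have hlattice (v : E) (hv : v ∈ Submodule.span ℤ (Set.range b)) : Function.Periodic g v := by
    induction hv using Submodule.span_induction with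
    | mem v hv => obtain ⟨i, rfl⟩ := hv; exact hp i
    | zero => exact fun x => by rw [add_zero]
    | add v w _ _ hv hw => exact hv.add_period hw
    | smul n v _ hv => exact hv.zsmul n
  refine ((isCompact_closedBall (0 : E) (∑ i, ‖b i‖)).image hg).isBounded.subset ?_
  rintro _ ⟨x, rfl⟩
  refine ⟨ZSpan.fract b x, by simpa using ZSpan.norm_fract_le b x, ?_⟩
  exact (hlattice _ (ZSpan.floor b x).2).sub_eq x

theorem eq_zero_of_differentiable_of_quasiperiodic {F : Type*} [NormedAddCommGroup F]
    [NormedSpace ℂ F] (L : PeriodPair) {f : ℂ → F} {u₁ u₂ : ℂ} (hf : Differentiable ℂ f)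
    (h₁ : ∀ z, f (z + L.ω₁) = u₁ • f z) (h₂ : ∀ z, f (z + L.ω₂) = u₂ • f z)
    (hu₁ : ‖u₁‖ = 1) (hu₂ : ‖u₂‖ = 1) (hne : u₁ ≠ 1) : f = 0 := by
  have hnorm : Bornology.IsBounded (Set.range fun z => ‖f z‖) := by
    refine isBounded_range_of_basis_periodic L.basis hf.continuous.norm fun i z => ?_
    fin_cases i
    · simp [h₁, norm_smul, hu₁]
    · simp [h₂, norm_smul, hu₂]
  obtain ⟨C, hC⟩ := isBounded_iff_forall_norm_le.1 hnorm
  have hbdd : Bornology.IsBounded (Set.range f) :=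
    isBounded_iff_forall_norm_le.2 ⟨C, Set.forall_mem_range.2 fun z => by
      simpa using hC _ (Set.mem_range_self z)⟩
  funext z
  have hconst : u₁ • f z = f z := by rw [← h₁, hf.apply_eq_apply_of_bounded hbdd]
  have hsmul : (u₁ - 1) • f z = 0 := by rw [sub_smul, one_smul, hconst, sub_self]
  exact (smul_eq_zero.1 hsmul).resolve_left (sub_ne_zero.2 hne)

theorem exists_analyticOnNhd_eventuallyEq_nhdsNE {𝕜 F : Type*} [NontriviallyNormedField 𝕜]
    [NormedAddCommGroup F] [NormedSpace 𝕜 F] {H : 𝕜 → F}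
    (h : ∀ z, ∃ k : 𝕜 → F, AnalyticAt 𝕜 k z ∧ H =ᶠ[𝓝[≠] z] k) :
    ∃ E : 𝕜 → F, AnalyticOnNhd 𝕜 E Set.univ ∧ ∀ z, H =ᶠ[𝓝[≠] z] E := by
  have hmer : MeromorphicOn H Set.univ := fun z _ =>
    let ⟨_, hk, hHk⟩ := h z
    hk.meromorphicAt.congr hHk.symm
  refine ⟨toMeromorphicNFOn H Set.univ, fun z hz => ?_, fun z =>
    (hmer.toMeromorphicNFOn_eq_self_on_nhdsNE (Set.mem_univ z)).symm⟩
  have hnf := meromorphicNFOn_toMeromorphicNFOn H Set.univ hz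
  refine hnf.meromorphicOrderAt_nonneg_iff_analyticAt.1 ?_
  obtain ⟨k, hk, hHk⟩ := h z
  rw [meromorphicOrderAt_toMeromorphicNFOn hmer hz, meromorphicOrderAt_congr hHk]
  exact hk.meromorphicOrderAt_nonneg

theorem eventuallyEq_zero_of_quasiperiodic_of_removable {F : Type*} [NormedAddCommGroup F]
    [NormedSpace ℂ F] (L : PeriodPair) {H : ℂ → F} {u₁ u₂ : ℂ}
    (h₁ : ∀ z, H (z + L.ω₁) = u₁ • H z) (h₂ : ∀ z, H (z + L.ω₂) = u₂ • H z)
    (hu₁ : ‖u₁‖ = 1) (hu₂ : ‖u₂‖ = 1) (hne : u₁ ≠ 1)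
    (hrem : ∀ z, ∃ k : ℂ → F, AnalyticAt ℂ k z ∧ H =ᶠ[𝓝[≠] z] k) (z : ℂ) :
    H =ᶠ[𝓝[≠] z] 0 := by
  obtain ⟨E, hE, hHE⟩ := exists_analyticOnNhd_eventuallyEq_nhdsNE hrem
  have hdiff : Differentiable ℂ E := fun z => (hE z (Set.mem_univ z)).differentiableAt
  have hcont := hdiff.continuous
  have hshift {l u : ℂ} (h : ∀ z, H (z + l) = u • H z) (z : ℂ) : E (z + l) = u • E z := by
    have ht : Tendsto (· + l) (𝓝[≠] z) (𝓝[≠] (z + l)) :=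
      ((Homeomorph.addRight l).map_punctured_nhds_eq z).le
    have hev : (fun w => E (w + l)) =ᶠ[𝓝[≠] z] fun w => u • E w := by
      filter_upwards [hHE z, ht.eventually (hHE (z + l))] with w hw hw'
      rw [← hw, ← hw', h]
    exact ((ContinuousAt.eventuallyEq_nhds_iff_eventuallyEq_nhdsNE
      (by fun_prop) (by fun_prop)).1 hev).eq_of_nhds
  have hzero := eq_zero_of_differentiable_of_quasiperiodic L hdiff (hshift h₁) (hshift h₂)
    hu₁ hu₂ hne
  exact hzero ▸ hHE z

/-! ### Functions determined up to an affine function -/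

/-- Affine functions `z ↦ a z + b` of one variable: the ambiguity of a Mittag-Leffler sum whose
terms are regularised to order two. -/
def IsAffineFunction {R : Type*} [Semiring R] (f : R → R) : Prop :=
  ∃ a b, ∀ z, f z = a * z + b

section Affine

variable {K : Type*} [Field K] {f g S : K → K} {l u : K}

theorem IsAffineFunction.eq_zero_of_quasiperiodic (hf : IsAffineFunction f) (hu : u ≠ 1)
    (h : ∀ z, f (z + l) = u * f z) : f = 0 := by
  obtain ⟨a, b, hab⟩ := hf
  have hu' := sub_ne_zero.2 hu
  simp only [hab] at h
  have ha : (u - 1) * a = 0 := by linear_combination h 0 - h 1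
  obtain rfl := (mul_eq_zero.1 ha).resolve_left hu'
  have hb : (u - 1) * b = 0 := by linear_combination -h 0
  obtain rfl := (mul_eq_zero.1 hb).resolve_left hu'
  funext z
  simp [hab]

theorem eq_of_quasiperiodic_of_isAffineFunction_sub (hu : u ≠ 1)
    (hf : ∀ z, f (z + l) = u * f z) (hg : ∀ z, g (z + l) = u * g z)
    (h : IsAffineFunction fun z => f z - g z) : f = g :=
  funext fun z => sub_eq_zero.1 <| congrFun
    (h.eq_zero_of_quasiperiodic hu fun z => by rw [hf, hg, mul_sub]) z

theorem exists_quasiperiodic_of_isAffineFunction (hu : u ≠ 1)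
    (hS : IsAffineFunction fun z => S (z + l) - u * S z) :
    ∃ f : K → K, IsAffineFunction (fun z => f z - S z) ∧ ∀ z, f (z + l) = u * f z := by
  obtain ⟨c, d, h⟩ := hS
  have hu' := sub_ne_zero.2 hu
  refine ⟨fun z => S z + (c / (u - 1) * z + (d + c / (u - 1) * l) / (u - 1)), ⟨_, _, fun z =>
    add_sub_cancel_left _ _⟩, fun z => ?_⟩
  dsimp only
  rw [eq_add_of_sub_eq (h z)]
  field_simp
  ring

theorem eq_of_isAffineFunction_symmetry {α β v : K} (hu : u ≠ 1)
    (hfS : IsAffineFunction fun z => f z - S z) (hf : ∀ z, f (z + l) = u * f z)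
    (hS : IsAffineFunction fun z => α * S (α * z + β) - v * S z)
    (hαβ : ∀ z, f (α * (z + l) + β) = u * f (α * z + β)) (z : K) :
    α * f (α * z + β) = v * f z := by
  refine congrFun (eq_of_quasiperiodic_of_isAffineFunction_sub (l := l) (u := u)
    (f := fun z => α * f (α * z + β)) (g := fun z => v * f z) hu
    (fun z => by rw [hαβ]; ring) (fun z => by rw [hf]; ring) ?_) z
  obtain ⟨a, b, hab⟩ := hfS
  obtain ⟨c, d, hcd⟩ := hS
  exact ⟨c + α * a * α - v * a, d + α * (a * β + b) - v * b, fun z => by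
    linear_combination α * hab (α * z + β) - v * hab z + hcd z⟩

end Affine

theorem IsAffineFunction.iteratedDeriv_eq_zero {𝕜 : Type*} [NontriviallyNormedField 𝕜]
    {f : 𝕜 → 𝕜} (hf : IsAffineFunction f) {n : ℕ} (hn : 2 ≤ n) : iteratedDeriv n f = 0 := by
  obtain ⟨a, b, hab⟩ := hf
  obtain ⟨k, rfl⟩ := Nat.exists_eq_add_of_le' hn
  have hderiv : deriv f = fun _ => a := by
    funext z
    rw [funext hab, deriv_add_const, deriv_const_mul_field, deriv_id'', mul_one]
  funext z
  rw [iteratedDeriv_succ', iteratedDeriv_succ', hderiv, deriv_const', iteratedDeriv_fun_const_zero,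
    Pi.zero_apply]

theorem IsAffineFunction.analyticAt {𝕜 : Type*} [NontriviallyNormedField 𝕜] {f : 𝕜 → 𝕜}
    (hf : IsAffineFunction f) (z : 𝕜) : AnalyticAt 𝕜 f z := by
  obtain ⟨a, b, hab⟩ := hf
  rw [funext hab]
  fun_prop

/-! ### Mittag-Leffler sums -/

/-- The simple fraction with residue `a` at `w`, minus its Taylor polynomial of degree one at the
origin; it is `a / z` when `w = 0`. -/
noncomputable def mittagLefflerTerm (a w z : ℂ) : ℂ := a * (1 / (z - w) + 1 / w + z / w ^ 2)

/-- The conditions on residues `c i` and poles `p i` under which the sum of the simple fractions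
`c i / (z - p i)` converges once regularised to order two. -/
structure IsMittagLefflerFamily {ι : Type*} (c p : ι → ℂ) : Prop where
  tendsto_norm : Tendsto (fun i => ‖p i‖) cofinite atTop
  summable_norm_div : Summable fun i => ‖c i‖ / ‖p i‖ ^ 3

/-- The regularised sum of the simple fractions with residues `c i` at the points `p i`. -/
noncomputable def mittagLefflerSum {ι : Type*} (c p : ι → ℂ) (z : ℂ) : ℂ :=
  ∑' i, mittagLefflerTerm (c i) (p i) z

theorem mittagLefflerTerm_eq {a w z : ℂ} (hw : w ≠ 0) (hz : z ≠ w) :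
    mittagLefflerTerm a w z = a * (z ^ 2 / (w ^ 2 * (z - w))) := by
  have := sub_ne_zero.2 hz
  rw [mittagLefflerTerm]; field_simp; ring

theorem norm_mittagLefflerTerm_le {a w z : ℂ} {R : ℝ} (hz : ‖z‖ ≤ R) (hw : 2 * R < ‖w‖) :
    ‖mittagLefflerTerm a w z‖ ≤ 2 * R ^ 2 * (‖a‖ / ‖w‖ ^ 3) := by
  have hw0 : 0 < ‖w‖ := by linarith [norm_nonneg z]
  have hzw : ‖w‖ / 2 ≤ ‖z - w‖ := by
    rw [norm_sub_rev]
    linarith [norm_sub_norm_le w z]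
  have hne : z ≠ w := by
    rintro rfl
    linarith
  rw [mittagLefflerTerm_eq (norm_pos_iff.1 hw0) hne, norm_mul, norm_div, norm_mul, norm_pow,
    norm_pow]
  calc ‖a‖ * (‖z‖ ^ 2 / (‖w‖ ^ 2 * ‖z - w‖))
      ≤ ‖a‖ * (R ^ 2 / (‖w‖ ^ 2 * (‖w‖ / 2))) := by gcongr
    _ = 2 * R ^ 2 * (‖a‖ / ‖w‖ ^ 3) := by field_simp

theorem analyticAt_mittagLefflerTerm {a w z : ℂ} (h : z ≠ w) :
    AnalyticAt ℂ (mittagLefflerTerm a w) z := by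
  have := sub_ne_zero.2 h
  unfold mittagLefflerTerm
  simp only [div_eq_mul_inv _ (w ^ 2)]
  fun_prop (disch := assumption)

theorem conj_mittagLefflerSum {ι : Type*} {c p : ι → ℂ} {σ : Equiv.Perm ι}
    (hp : ∀ i, p (σ i) = conj (p i)) (hc : ∀ i, c (σ i) = conj (c i)) (z : ℂ) :
    conj (mittagLefflerSum c p (conj z)) = mittagLefflerSum c p z := by
  rw [mittagLefflerSum, mittagLefflerSum, Complex.conj_tsum, ← σ.tsum_eq]
  refine tsum_congr fun i => ?_
  simp only [mittagLefflerTerm, hp, hc, map_mul, map_add, map_div₀, map_sub, map_pow, map_one,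
    conj_conj]

namespace IsMittagLefflerFamily

variable {ι : Type*} {c p : ι → ℂ}

theorem comp_injective (h : IsMittagLefflerFamily c p) {κ : Type*} {e : κ → ι}
    (he : Function.Injective e) :
    IsMittagLefflerFamily (c ∘ e) (p ∘ e) :=
  ⟨h.tendsto_norm.comp he.tendsto_cofinite, h.summable_norm_div.comp_injective he⟩

theorem finite_norm_le (h : IsMittagLefflerFamily c p) (R : ℝ) : {i | ‖p i‖ ≤ R}.Finite := by
  have := h.tendsto_norm.eventually_gt_atTop R
  simpa only [eventually_cofinite, not_lt] using this

theorem summable (h : IsMittagLefflerFamily c p) (z : ℂ) :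
    Summable fun i => mittagLefflerTerm (c i) (p i) z := by
  refine (h.summable_norm_div.mul_left (2 * ‖z‖ ^ 2)).of_norm_bounded_eventually ?_
  filter_upwards [h.tendsto_norm.eventually_gt_atTop (2 * ‖z‖)] with i hi
  exact norm_mittagLefflerTerm_le le_rfl hi

theorem differentiableOn_ball (h : IsMittagLefflerFamily c p) {R : ℝ} (hR : ∀ i, 2 * R < ‖p i‖) :
    DifferentiableOn ℂ (mittagLefflerSum c p) (ball 0 R) := by
  refine differentiableOn_tsum_of_summable_norm (h.summable_norm_div.mul_left (2 * R ^ 2))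
    (fun i z hz => ?_) isOpen_ball (fun i z hz => ?_)
  · have hz' : ‖z‖ < R := by simpa using hz
    have hne : z ≠ p i := by
      rintro rfl
      linarith [hR i, norm_nonneg (p i)]
    exact (analyticAt_mittagLefflerTerm hne).differentiableAt.differentiableWithinAt
  · exact norm_mittagLefflerTerm_le (by simpa using (mem_ball.1 hz).le) (hR i)

theorem sum_add_mittagLefflerSum_compl (h : IsMittagLefflerFamily c p) (s : Finset ι) (z : ℂ) :
    ∑ i ∈ s, mittagLefflerTerm (c i) (p i) z +
      mittagLefflerSum (c ∘ ((↑) : {i // i ∉ s} → ι)) (p ∘ (↑)) z = mittagLefflerSum c p z :=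
  (h.summable z).sum_add_tsum_subtype_compl s

theorem analyticAt (h : IsMittagLefflerFamily c p) {z : ℂ} (hz : z ∉ Set.range p) :
    AnalyticAt ℂ (mittagLefflerSum c p) z := by
  set R := ‖z‖ + 1
  set s := (h.finite_norm_le (2 * R)).toFinset with hs
  rw [← funext (h.sum_add_mittagLefflerSum_compl s)]
  refine (Finset.analyticAt_fun_sum _ fun i _ => analyticAt_mittagLefflerTerm ?_).fun_add ?_
  · rintro rfl
    exact hz ⟨i, rfl⟩
  · have hlarge (i : {i // i ∉ s}) : 2 * R < ‖p i‖ := by simpa [hs] using i.2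
    exact ((h.comp_injective Subtype.val_injective).differentiableOn_ball hlarge).analyticAt
      (isOpen_ball.mem_nhds (by simp [R]))

theorem exists_eq_div_add (h : IsMittagLefflerFamily c p) (hp : Function.Injective p) (i : ι) :
    ∃ r : ℂ → ℂ, AnalyticAt ℂ r (p i) ∧ ∀ z, mittagLefflerSum c p z = c i / (z - p i) + r z := by
  refine ⟨fun z => c i * (1 / p i + z * (p i ^ 2)⁻¹) + mittagLefflerSum
    (c ∘ ((↑) : {j // j ∉ ({i} : Finset ι)} → ι)) (p ∘ (↑)) z, ?_, fun z => ?_⟩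
  · refine AnalyticAt.fun_add (by fun_prop)
      ((h.comp_injective Subtype.val_injective).analyticAt ?_)
    rintro ⟨j, hj⟩
    exact j.2 (by simpa using hp hj)
  · rw [← h.sum_add_mittagLefflerSum_compl {i}, Finset.sum_singleton, mittagLefflerTerm]
    ring

theorem isAffineFunction_symmetry (h : IsMittagLefflerFamily c p) {σ : Equiv.Perm ι} {α β v : ℂ}
    (hα : α ≠ 0) (hp : ∀ i, p (σ i) = α * p i + β) (hc : ∀ i, c (σ i) = v * c i) :
    IsAffineFunction fun z =>
      α * mittagLefflerSum c p (α * z + β) - v * mittagLefflerSum c p z := by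
  set f : ℂ → ι → ℂ := fun z i => α * mittagLefflerTerm (c (σ i)) (p (σ i)) (α * z + β) -
    v * mittagLefflerTerm (c i) (p i) z with hf
  have hσ (z : ℂ) : Summable fun i => α * mittagLefflerTerm (c (σ i)) (p (σ i)) (α * z + β) :=
    (σ.summable_iff.2 (h.summable (α * z + β))).mul_left α
  have hv (z : ℂ) : Summable fun i => v * mittagLefflerTerm (c i) (p i) z :=
    (h.summable z).mul_left v
  have hsum (z : ℂ) : Summable (f z) := (hσ z).sub (hv z)
  have htsum (z : ℂ) : ∑' i, f z i =
      α * mittagLefflerSum c p (α * z + β) - v * mittagLefflerSum c p z := by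
    rw [hf, (hσ z).tsum_sub (hv z), tsum_mul_left, tsum_mul_left, mittagLefflerSum,
      mittagLefflerSum, σ.tsum_eq fun i => mittagLefflerTerm (c i) (p i) (α * z + β)]
  -- The polar parts cancel, so each term of the difference is affine in `z`.
  have hpolar (z : ℂ) (i : ι) : f z i = v * c i *
      (α * (1 / p (σ i) + (α * z + β) / p (σ i) ^ 2) - 1 / p i - z / p i ^ 2) := by
    have : α * (1 / (α * z + β - p (σ i))) = 1 / (z - p i) := by
      rw [hp, show α * z + β - (α * p i + β) = α * (z - p i) by ring, one_div, mul_inv,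
        mul_inv_cancel_left₀ hα, one_div]
    simp only [hf, mittagLefflerTerm, hc]
    linear_combination v * c i * this
  have haffine (z : ℂ) (i : ι) : f z i = (f 1 i - f 0 i) * z + f 0 i := by
    simp only [hpolar]; ring
  refine ⟨∑' i, (f 1 i - f 0 i), ∑' i, f 0 i, fun z => ?_⟩
  dsimp only
  rw [← htsum, funext (haffine z), (((hsum 1).sub (hsum 0)).mul_right z).tsum_add (hsum 0),
    tsum_mul_right]

end IsMittagLefflerFamily

/-! ### Taylor coefficients -/

theorem iteratedDeriv_eq_of_eventually_hasSum {𝕜 : Type*} [NontriviallyNormedField 𝕜]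
    [CompleteSpace 𝕜] [CharZero 𝕜] {f : 𝕜 → 𝕜} {x : 𝕜} {a : ℕ → 𝕜}
    (h : ∀ᶠ z in 𝓝 0, HasSum (fun n => z ^ n * a n) (f (x + z))) (n : ℕ) :
    iteratedDeriv n f x = n.factorial * a n := by
  have hseries : HasFPowerSeriesAt f (FormalMultilinearSeries.ofScalars 𝕜 a) x := by
    simpa only [hasFPowerSeriesAt_iff, FormalMultilinearSeries.coeff_ofScalars, smul_eq_mul] using h
  have hcoeff := congrArg (·.coeff n)
    (hseries.analyticAt.hasFPowerSeriesAt.eq_formalMultilinearSeries hseries)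
  simp only [FormalMultilinearSeries.coeff_ofScalars] at hcoeff
  rw [← hcoeff, mul_div_cancel₀ _ (Nat.cast_ne_zero.2 n.factorial_ne_zero)]

theorem hasSum_mittagLefflerTerm {a w z : ℂ} (hz : ‖z‖ < ‖w‖) :
    HasSum (fun k : ℕ => -(a * z ^ 2 / w ^ 3) * (z / w) ^ k) (mittagLefflerTerm a w z) := by
  have hw : w ≠ 0 := norm_pos_iff.1 ((norm_nonneg z).trans_lt hz)
  have hne : z ≠ w := fun h => hz.ne (congrArg norm h)
  have hzw := sub_ne_zero.2 hne
  have hwz := sub_ne_zero.2 hne.symm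
  have hratio : ‖z / w‖ < 1 := by rwa [norm_div, div_lt_one (norm_pos_iff.2 hw)]
  have hval : mittagLefflerTerm a w z = -(a * z ^ 2 / w ^ 3) * (1 - z / w)⁻¹ := by
    rw [mittagLefflerTerm_eq hw hne, one_sub_div hw]
    field_simp
    ring
  exact hval ▸ (hasSum_geometric_of_norm_lt_one hratio).mul_left _

namespace IsMittagLefflerFamily

variable {ι : Type*} {c p : ι → ℂ} {δ : ℝ}

theorem hasSum_of_norm_le (h : IsMittagLefflerFamily c p) (hδ : 0 < δ)
    (hp : ∀ i, δ ≤ ‖p i‖) {z : ℂ} (hz : ‖z‖ ≤ δ / 2) :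
    HasSum (fun k => z ^ (k + 2) * -∑' i, c i / p i ^ (k + 3)) (mittagLefflerSum c p z) := by
  set f : ι × ℕ → ℂ := fun x => -(c x.1 * z ^ 2 / p x.1 ^ 3) * (z / p x.1) ^ x.2 with hf
  have hsum : Summable f := by
    refine .of_norm_bounded (Summable.mul_of_nonneg (h.summable_norm_div.mul_left (‖z‖ ^ 2))
      summable_geometric_two (fun i => by positivity) (fun k => by positivity)) fun ⟨i, k⟩ => ?_
    have hratio : ‖z / p i‖ ≤ 1 / 2 := by
      rw [norm_div, div_le_iff₀ (hδ.trans_le (hp i))]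
      linarith [hp i]
    calc ‖f (i, k)‖ = ‖z‖ ^ 2 * (‖c i‖ / ‖p i‖ ^ 3) * ‖z / p i‖ ^ k := by
          simp only [hf, norm_mul, norm_neg, norm_div, norm_pow]; ring
      _ ≤ ‖z‖ ^ 2 * (‖c i‖ / ‖p i‖ ^ 3) * (1 / 2) ^ k := by gcongr
  have hrow (i : ι) : HasSum (fun k => f (i, k)) (mittagLefflerTerm (c i) (p i) z) := by
    have hzp : ‖z‖ < ‖p i‖ := by linarith [hp i]
    simpa only [hf] using hasSum_mittagLefflerTerm (a := c i) hzp
  have hcol (k : ℕ) : ∑' i, f (i, k) = z ^ (k + 2) * -∑' i, c i / p i ^ (k + 3) := by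
    rw [← tsum_neg, ← tsum_mul_left]
    refine tsum_congr fun i => ?_
    have := norm_pos_iff.1 (hδ.trans_le (hp i))
    simp only [hf, div_pow]
    field_simp
    ring
  have htotal : ∑' x, f x = mittagLefflerSum c p z := by
    simp only [hsum.tsum_prod, (hrow _).tsum_eq, mittagLefflerSum]
  have hswap : HasSum (fun k => ∑' i, f (i, k)) (∑' x, f x) := by
    rw [← (Equiv.prodComm ℕ ι).tsum_eq f]
    exact hsum.prod_symm.hasSum.prod_fiberwise fun k => (hsum.prod_symm.prod_factor k).hasSum
  simpa only [hcol, htotal] using hswap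

theorem iteratedDeriv_mittagLefflerSum_zero (h : IsMittagLefflerFamily c p) (hδ : 0 < δ)
    (hp : ∀ i, δ ≤ ‖p i‖) {n : ℕ} (hn : 2 ≤ n) :
    iteratedDeriv n (mittagLefflerSum c p) 0 = -(n.factorial * ∑' i, c i / p i ^ (n + 1)) := by
  have hseries : ∀ᶠ z in 𝓝 0, HasSum
      (fun k => z ^ k * if k < 2 then 0 else -∑' i, c i / p i ^ (k + 1))
      (mittagLefflerSum c p (0 + z)) := by
    filter_upwards [closedBall_mem_nhds (0 : ℂ) (half_pos hδ)] with z hz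
    rw [← hasSum_nat_add_iff' 2]
    simpa [Finset.sum_range_succ] using h.hasSum_of_norm_le hδ hp (by simpa using hz)
  rw [iteratedDeriv_eq_of_eventually_hasSum hseries, if_neg hn.not_gt, mul_neg]

end IsMittagLefflerFamily

/-! ### Simple poles -/

section SimplePole

variable {𝕜 : Type*} [NontriviallyNormedField 𝕜] {f g r s : 𝕜 → 𝕜} {a b p : 𝕜}

theorem meromorphicAt_of_eq_div_add (hr : AnalyticAt 𝕜 r p)
    (hf : ∀ z, f z = a / (z - p) + r z) : MeromorphicAt f p := by
  rw [funext hf]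
  have := hr.meromorphicAt
  fun_prop

theorem meromorphicOrderAt_ne_top_of_eq_div_add (ha : a ≠ 0) (hr : AnalyticAt 𝕜 r p)
    (hf : ∀ z, f z = a / (z - p) + r z) : meromorphicOrderAt f p ≠ ⊤ := by
  have horder : meromorphicOrderAt f p = (-1 : ℤ) := by
    rw [meromorphicOrderAt_eq_int_iff (meromorphicAt_of_eq_div_add hr hf)]
    refine ⟨fun z => a + (z - p) * r z, by fun_prop, by simpa using ha, ?_⟩
    filter_upwards [self_mem_nhdsWithin] with z hz
    have := sub_ne_zero.2 hz
    rw [hf, zpow_neg_one, smul_eq_mul]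
    field_simp
  rw [horder]
  exact WithTop.coe_ne_top

theorem deriv_add_sq_removable [CompleteSpace 𝕜] (hr : AnalyticAt 𝕜 r p) (hs : AnalyticAt 𝕜 s p)
    (hf : ∀ z, f z = a / (z - p) + r z) (hg : ∀ z, g z = b / (z - p) + s z)
    (hba : b ^ 2 = a) (hsp : s p = 0) :
    ∃ k : 𝕜 → 𝕜, AnalyticAt 𝕜 k p ∧ (fun z => deriv f z + g z ^ 2) =ᶠ[𝓝[≠] p] k := by
  have hslope : AnalyticAt 𝕜 (dslope s p) p :=
    let ⟨_, hq⟩ := hs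
    hq.has_fpower_series_dslope_fslope.analyticAt
  refine ⟨fun z => deriv r z + 2 * b * dslope s p z + s z ^ 2,
    (hr.deriv.fun_add (analyticAt_const.fun_mul hslope)).fun_add (hs.fun_pow 2), ?_⟩
  filter_upwards [self_mem_nhdsWithin, hr.eventually_analyticAt.filter_mono nhdsWithin_le_nhds]
    with z hz hrz
  have hzp : z - p ≠ 0 := sub_ne_zero.2 hz
  have hderiv : deriv f z = -a / (z - p) ^ 2 + deriv r z := by
    have hdiv : HasDerivAt (fun z => a / (z - p)) (-a / (z - p) ^ 2) z := by
      simpa using (hasDerivAt_const z a).fun_div ((hasDerivAt_id z).sub_const p) hzp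
    rw [funext hf]
    exact (hdiv.add hrz.differentiableAt.hasDerivAt).deriv
  have hs_eq : s z = (z - p) * dslope s p z := by
    simpa [hsp] using (sub_smul_dslope s p z).symm
  rw [hderiv, hg, ← hba, hs_eq]
  field_simp
  ring

end SimplePole

/-! ### The differential equation -/

/-- The functional differential equation `deriv f z = -f (-z) ^ 2` on a set: comparing Taylor
coefficients at the origin turns it into the recursion of the pseudo-factorials. -/
def SolvesReflectedRiccati {𝕜 : Type*} [NontriviallyNormedField 𝕜] (f : 𝕜 → 𝕜) (s : Set 𝕜) :
    Prop :=
  ∀ z ∈ s, HasDerivAt f (-f (-z) ^ 2) z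

namespace SolvesReflectedRiccati

theorem iteratedDeriv_zero {𝕜 : Type*} [NontriviallyNormedField 𝕜] {f : 𝕜 → 𝕜} {s : Set 𝕜}
    (h : SolvesReflectedRiccati f s) (hs : s ∈ 𝓝 0) (hf : ContDiffAt 𝕜 ∞ f 0) (n : ℕ) :
    iteratedDeriv n f 0 = f 0 ^ (n + 1) * pseudoFactorial n := by
  induction n using Nat.strong_induction_on with
  | _ n ih =>
    rcases n with - | n
    · simp [pseudoFactorial_zero]
    · have hderiv : deriv f =ᶠ[𝓝 0] fun z => (fun w => -(f w * f w)) (-z) := by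
        filter_upwards [hs] with z hz
        rw [(h z hz).deriv, pow_two]
      rw [iteratedDeriv_succ', hderiv.iteratedDeriv_eq,
        iteratedDeriv_comp_neg n (fun w => -(f w * f w)), neg_zero, iteratedDeriv_fun_neg,
        iteratedDeriv_fun_mul (hf.of_le (mod_cast le_top)) (hf.of_le (mod_cast le_top)),
        pseudoFactorial_succ]
      push_cast
      rw [smul_eq_mul, ← Finset.sum_neg_distrib, Finset.mul_sum, Finset.mul_sum, Finset.mul_sum]
      refine Finset.sum_congr rfl fun k hk => ?_
      have hk' : k ≤ n := by simpa [Nat.lt_succ_iff] using hk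
      obtain ⟨m, rfl⟩ := Nat.exists_eq_add_of_le hk'
      rw [ih k (by omega), ih (k + m - k) (by omega), Nat.add_sub_cancel_left]
      ring

theorem apply_zero_ne_zero {f : ℂ → ℂ} {s : Set ℂ} (h : SolvesReflectedRiccati f s)
    (hs : s ∈ 𝓝 0) (hf : Meromorphic f) {p : ℂ} (hp : meromorphicOrderAt f p ≠ ⊤) : f 0 ≠ 0 := by
  intro hzero
  have h0 : AnalyticAt ℂ f 0 := analyticAt_iff_eventually_differentiableAt.2 <|
    Filter.mem_of_superset hs fun z hz => (h z hz).differentiableAt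
  have hcoeff (n : ℕ) : iteratedDeriv n f 0 = 0 := by
    rw [h.iteratedDeriv_zero hs h0.contDiffAt, hzero, zero_pow n.succ_ne_zero, zero_mul]
  have hvanish : f =ᶠ[𝓝 0] 0 := by
    filter_upwards [hasFPowerSeriesAt_iff.1 h0.hasFPowerSeriesAt] with z hz
    simpa [FormalMultilinearSeries.coeff_ofScalars, hcoeff] using hz.tsum_eq.symm
  have htop : meromorphicOrderAt f 0 ≠ ⊤ :=
    hf.exists_meromorphicOrderAt_ne_top_iff_forall.1 ⟨p, hp⟩ 0
  exact htop (meromorphicOrderAt_eq_top_iff.2 (hvanish.filter_mono nhdsWithin_le_nhds))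

theorem re_comp_ofReal {f : ℂ → ℂ} {s : Set ℂ} (h : SolvesReflectedRiccati f s)
    (hreal : ∀ x : ℝ, (f x).im = 0) {t : Set ℝ} (ht : ∀ x ∈ t, (x : ℂ) ∈ s) :
    SolvesReflectedRiccati (fun x : ℝ => (f x).re) t := by
  intro x hx
  have hval : f (-x) = ((f ((-x : ℝ) : ℂ)).re : ℝ) :=
    Complex.ext (by simp) (by simpa using hreal (-x))
  have hderiv := h x (ht x hx)
  rw [hval, ← ofReal_pow, ← ofReal_neg] at hderiv
  exact hderiv.real_of_complex

section Real

variable {g : ℝ → ℝ} {c : ℝ}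

theorem hasDerivAt_comp_neg (hg : SolvesReflectedRiccati g (Set.Icc (-c) c)) {x : ℝ}
    (hx : x ∈ Set.Icc (-c) c) :
    HasDerivAt (fun y => g (-y)) (g x ^ 2) x := by
  have hx' : -x ∈ Set.Icc (-c) c := by simpa [and_comm, neg_le] using hx
  simpa [Function.comp_def] using (hg (-x) hx').scomp x (hasDerivAt_neg x)

theorem cube_add_cube_neg (hg : SolvesReflectedRiccati g (Set.Icc (-c) c)) {x : ℝ}
    (hx : x ∈ Set.Icc (-c) c) :
    g x ^ 3 + g (-x) ^ 3 = 2 * g 0 ^ 3 := by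
  have hderiv (y : ℝ) (hy : y ∈ Set.Icc (-c) c) :
      HasDerivAt (fun y => g y ^ 3 + g (-y) ^ 3) 0 y :=
    (((hg y hy).fun_pow 3).fun_add ((hg.hasDerivAt_comp_neg hy).fun_pow 3)).congr_deriv
      (by push_cast; ring)
  have h0 : (0 : ℝ) ∈ Set.Icc (-c) c := by constructor <;> linarith [hx.1, hx.2]
  have hconst := constant_of_has_deriv_right_zero
    (fun y hy => (hderiv y hy).continuousAt.continuousWithinAt)
    fun y hy => (hderiv y (Set.Ico_subset_Icc_self hy)).hasDerivWithinAt
  simpa only [neg_zero, ← two_mul] using (hconst x hx).trans (hconst 0 h0).symm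

theorem antitoneOn (hg : SolvesReflectedRiccati g (Set.Icc (-c) c)) :
    AntitoneOn g (Set.Icc (-c) c) :=
  antitoneOn_of_hasDerivWithinAt_nonpos (convex_Icc _ _)
    (fun x hx => (hg x hx).continuousAt.continuousWithinAt)
    (fun x hx => (hg x (interior_subset hx)).hasDerivWithinAt)
    fun _ _ => neg_nonpos.2 (sq_nonneg _)

theorem apply_neg_eq (hg : SolvesReflectedRiccati g (Set.Icc (-c) c)) (hc : 0 < c)
    (hgc : g c = 0) : g (-c) = (2 : ℝ) ^ (1 / 3 : ℝ) * g 0 := by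
  have h2 : ((2 : ℝ) ^ (1 / 3 : ℝ)) ^ 3 = 2 := by
    rw [← Real.rpow_natCast, ← Real.rpow_mul zero_le_two]; norm_num
  refine (Odd.strictMono_pow (by decide : Odd 3)).injective ?_
  have hcube := hg.cube_add_cube_neg (x := c) ⟨by linarith, le_rfl⟩
  simp only [hgc] at hcube
  simp only [mul_pow, h2]
  linear_combination hcube

theorem apply_zero_pos (hg : SolvesReflectedRiccati g (Set.Icc (-c) c)) (hc : 0 < c)
    (hgc : g c = 0) (h0 : g 0 ≠ 0) : 0 < g 0 := by
  have hle := hg.antitoneOn ⟨by linarith, hc.le⟩ ⟨by linarith, le_rfl⟩ hc.le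
  exact (hgc ▸ hle).lt_of_ne' h0

theorem apply_pos (hg : SolvesReflectedRiccati g (Set.Icc (-c) c)) (hc : 0 < c)
    (hgc : g c = 0) (h0 : g 0 ≠ 0) {x : ℝ} (hx : x ∈ Set.Ico (-c) c) : 0 < g x := by
  have hnonpos (y : ℝ) (hy : y ∈ Set.Icc (-c) 0) : 0 < g y :=
    (hg.apply_zero_pos hc hgc h0).trans_le
      (hg.antitoneOn ⟨hy.1, hy.2.trans hc.le⟩ ⟨by linarith, hc.le⟩ hy.2)
  rcases le_total x 0 with hx0 | hx0
  · exact hnonpos x ⟨hx.1, hx0⟩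
  · have hsub : Set.Icc 0 c ⊆ Set.Icc (-c) c := Set.Icc_subset_Icc_left (by linarith)
    have hstrict : StrictAntiOn g (Set.Icc 0 c) := by
      refine strictAntiOn_of_hasDerivWithinAt_neg (convex_Icc _ _)
        (fun y hy => (hg y (hsub hy)).continuousAt.continuousWithinAt)
        (fun y hy => (hg y (hsub (interior_subset hy))).hasDerivWithinAt) fun y hy => ?_
      have hy' := interior_subset hy
      exact neg_neg_of_pos (pow_pos (hnonpos (-y) ⟨by linarith [hy'.2], by linarith [hy'.1]⟩) 2)
    exact hgc ▸ hstrict ⟨hx0, hx.2.le⟩ ⟨hc.le, le_rfl⟩ hx.2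

theorem one_sub_cube_div (hg : SolvesReflectedRiccati g (Set.Icc (-c) c)) (hc : 0 < c)
    (hgc : g c = 0) (h0 : g 0 ≠ 0) {x : ℝ} (hx : x ∈ Set.Icc (-c) c) :
    1 - (g (-x) / g (-c)) ^ 3 = (g x / g (-c)) ^ 3 := by
  have hm : g (-c) ≠ 0 := (hg.apply_pos hc hgc h0 ⟨le_rfl, by linarith⟩).ne'
  have hend := hg.cube_add_cube_neg (x := c) ⟨by linarith, le_rfl⟩
  rw [div_pow, div_pow, one_sub_div (pow_ne_zero 3 hm)]
  simp only [hgc] at hend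
  congr 1
  linear_combination hend - hg.cube_add_cube_neg hx

theorem integral_eq (hg : SolvesReflectedRiccati g (Set.Icc (-c) c)) (hc : 0 < c)
    (hgc : g c = 0) (h0 : g 0 ≠ 0) :
    ∫ y in (0 : ℝ)..1, 1 / (1 - y ^ 3) ^ (2 / 3 : ℝ) = g (-c) * (2 * c) := by
  set m := g (-c)
  have hm : 0 < m := hg.apply_pos hc hgc h0 ⟨le_rfl, by linarith⟩
  have hle : -c ≤ c := by linarith
  have hderiv {x : ℝ} (hx : x ∈ Set.Icc (-c) c) :
      HasDerivAt (fun x => g (-x) / m) (g x ^ 2 / m) x :=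
    (hg.hasDerivAt_comp_neg hx).div_const m
  have hsubst := MeasureTheory.integral_Icc_deriv_smul_of_deriv_nonneg
    (g := fun y : ℝ => 1 / (1 - y ^ 3) ^ (2 / 3 : ℝ))
    (fun x hx => (hderiv hx).continuousAt.continuousWithinAt)
    (fun x hx => hderiv (Set.Ioo_subset_Icc_self hx)) (fun x _ => by positivity) hle
  have hconst {x : ℝ} (hx : x ∈ Set.Ico (-c) c) :
      (g x ^ 2 / m) • (1 / (1 - (g (-x) / m) ^ 3) ^ (2 / 3 : ℝ)) = m := by
    have hgx := hg.apply_pos hc hgc h0 hx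
    have hroot : ((g x / m) ^ 3) ^ (2 / 3 : ℝ) = (g x / m) ^ 2 := by
      rw [← Real.rpow_natCast, ← Real.rpow_mul (by positivity), ← Real.rpow_natCast]
      norm_num
    rw [hg.one_sub_cube_div hc hgc h0 (Set.Ico_subset_Icc_self hx), hroot, smul_eq_mul]
    field_simp
  rw [neg_neg, hgc, zero_div, div_self hm.ne', MeasureTheory.integral_Icc_eq_integral_Ico,
    MeasureTheory.setIntegral_congr_fun measurableSet_Ico fun x hx => hconst hx,
    MeasureTheory.setIntegral_const, Real.volume_real_Ico_of_le hle, smul_eq_mul] at hsubst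
  rw [intervalIntegral.integral_of_le zero_le_one, ← MeasureTheory.integral_Icc_eq_integral_Ioc,
    ← hsubst]
  ring

theorem piThree_eq (hg : SolvesReflectedRiccati g (Set.Icc (-c) c)) (hc : 0 < c)
    (hgc : g c = 0) (h0 : g 0 ≠ 0) :
    piThree = (2 : ℝ) ^ (1 / 3 : ℝ) * g 0 * (6 * c) := by
  rw [piThree, hg.integral_eq hc hgc h0, hg.apply_neg_eq hc hgc]
  ring

end Real

end SolvesReflectedRiccati

/-! ### Lattices -/

theorem summable_norm_lattice_sub_inv_pow (L : PeriodPair) {n : ℕ} (hn : 2 < n) (x : ℂ) :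
    Summable fun i : ℤ × ℤ => ‖i.1 * L.ω₁ + i.2 * L.ω₂ - x‖⁻¹ ^ n := by
  simpa only [Function.comp_def, L.latticeEquiv_symm_apply] using
    (ZLattice.summable_norm_sub_inv_pow L.lattice n (by simpa using hn) x).comp_injective
      L.latticeEquivProd.symm.injective

theorem isMittagLefflerFamily_lattice_sub (L : PeriodPair) {c : ℤ × ℤ → ℂ} {C : ℝ}
    (hc : ∀ i, ‖c i‖ ≤ C) (x : ℂ) :
    IsMittagLefflerFamily c fun i => i.1 * L.ω₁ + i.2 * L.ω₂ - x where
  tendsto_norm := by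
    have hlattice : Tendsto ((↑) : L.lattice → ℂ) cofinite (cocompact ℂ) :=
      AddSubgroup.tendsto_coe_cofinite_of_discrete L.lattice.toAddSubgroup
        (isDiscrete_iff_discreteTopology.2 (inferInstanceAs (DiscreteTopology L.lattice)))
    have hsub := (Homeomorph.subRight x).isClosedEmbedding.tendsto_cocompact.comp hlattice
    simpa only [Function.comp_def, Homeomorph.coe_subRight, L.latticeEquiv_symm_apply] using
      (tendsto_norm_cocompact_atTop.comp hsub).comp
        L.latticeEquivProd.symm.injective.tendsto_cofinite
  summable_norm_div := by
    refine .of_nonneg_of_le (fun i => by positivity) (fun i => ?_)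
      ((summable_norm_lattice_sub_inv_pow L (by norm_num : 2 < 3) x).mul_left C)
    rw [inv_pow, ← div_eq_mul_inv]
    gcongr
    exact hc i

/-! ### The hexagonal lattice -/

theorem hexZeta_eq : hexZeta = ⟨√3 / 2, 1 / 2⟩ := by
  have hexp : I * (Real.pi : ℂ) / 6 = (Real.pi / 6 : ℝ) * I := by push_cast; ring
  rw [hexZeta, hexp]
  apply Complex.ext
  · rw [exp_ofReal_mul_I_re, Real.cos_pi_div_six]
  · rw [exp_ofReal_mul_I_im, Real.sin_pi_div_six]

theorem hexZeta_ne_zero : hexZeta ≠ 0 := Complex.exp_ne_zero _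

theorem norm_hexZeta : ‖hexZeta‖ = 1 := by
  rw [hexZeta, Complex.norm_exp]
  simp

theorem hexZeta_inv_eq_conj : hexZeta⁻¹ = conj hexZeta := inv_eq_conj norm_hexZeta

theorem hexZeta_add_inv : hexZeta + hexZeta⁻¹ = (√3 : ℝ) := by
  rw [hexZeta_inv_eq_conj, add_conj, hexZeta_eq]
  push_cast
  ring

theorem hexZeta_pow_four : hexZeta ^ 4 = hexZeta ^ 2 - 1 := by
  have hsq : (hexZeta + hexZeta⁻¹) ^ 2 = 3 := by
    rw [hexZeta_add_inv, ← ofReal_pow, Real.sq_sqrt zero_le_three, ofReal_ofNat]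
  have := hexZeta_ne_zero
  field_simp at hsq
  linear_combination hsq

/-- The primitive cube root of unity `ω = ζ ^ 4`, in terms of which the numerators of the lattice
sum are `ω ^ (2 λ + μ)`. -/
noncomputable def hexOmega : ℂ := hexZeta ^ 4

theorem hexOmega_pow_three : hexOmega ^ 3 = 1 := by
  rw [hexOmega]
  linear_combination (hexZeta ^ 6 - 1) * (hexZeta ^ 2 + 1) * hexZeta_pow_four

theorem hexOmega_ne_zero : hexOmega ≠ 0 := pow_ne_zero _ hexZeta_ne_zero

theorem hexOmega_mul_zeta : hexOmega * hexZeta = -hexZeta⁻¹ := by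
  have := hexZeta_ne_zero
  rw [hexOmega]
  field_simp
  linear_combination (hexZeta ^ 2 + 1) * hexZeta_pow_four

theorem hexOmega_mul_zeta_inv : hexOmega * hexZeta⁻¹ = hexZeta - hexZeta⁻¹ := by
  have := hexZeta_ne_zero
  rw [hexOmega]
  field_simp
  linear_combination hexZeta_pow_four

theorem hexOmega_ne_one : hexOmega ≠ 1 := by
  intro h
  have hzero : ((√3 : ℝ) : ℂ) = 0 := by
    rw [← hexZeta_add_inv]
    linear_combination hexOmega_mul_zeta - hexZeta * h
  simp at hzero

theorem hexOmega_sq_ne_one : hexOmega ^ 2 ≠ 1 := fun h =>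
  hexOmega_ne_one (by linear_combination hexOmega_pow_three - hexOmega * h)

theorem norm_hexOmega : ‖hexOmega‖ = 1 := by rw [hexOmega, norm_pow, norm_hexZeta, one_pow]

theorem conj_hexOmega : conj hexOmega = hexOmega ^ 2 := by
  rw [← inv_eq_conj norm_hexOmega]
  exact inv_eq_of_mul_eq_one_right (by linear_combination hexOmega_pow_three)

theorem hexOmega_zpow_eq_of_modEq {a b : ℤ} (h : a ≡ b [ZMOD 3]) :
    hexOmega ^ a = hexOmega ^ b := by
  obtain ⟨k, hk⟩ := h.symm.dvd
  rw [eq_add_of_sub_eq' hk, zpow_add₀ hexOmega_ne_zero, zpow_mul]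
  simp [zpow_ofNat, hexOmega_pow_three]

/-- The period pair `(ζ, ζ⁻¹)` of the hexagonal lattice. -/
noncomputable def hexPeriodPair : PeriodPair where
  ω₁ := hexZeta
  ω₂ := hexZeta⁻¹
  indep := by
    rw [LinearIndependent.pair_iff, hexZeta_inv_eq_conj, hexZeta_eq]
    intro s t h
    have hre := congrArg re h
    have him := congrArg im h
    simp only [add_re, add_im, smul_re, smul_im, conj_re, conj_im, zero_re, zero_im,
      smul_eq_mul] at hre him
    have hsum : s + t = 0 :=
      (mul_eq_zero.1 ((add_mul s t (√3 / 2)).trans hre)).resolve_right (by positivity)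
    constructor <;> linarith

/-- The poles of the lattice sum, indexed by `(λ, μ)`: the hexagonal lattice translated by half a
period. -/
noncomputable def hexPole (i : ℤ × ℤ) : ℂ :=
  ((i.1 : ℂ) - 1 / 2) * hexZeta + ((i.2 : ℂ) - 1 / 2) * hexZeta⁻¹

/-- The numerators of the lattice sum: a character of the lattice, serving as residues. -/
noncomputable def hexChar (i : ℤ × ℤ) : ℂ := hexZeta ^ (8 * i.1 + 4 * i.2)

theorem hexPole_eq_lattice_sub : hexPole = fun i =>
    i.1 * hexPeriodPair.ω₁ + i.2 * hexPeriodPair.ω₂ - (hexZeta + hexZeta⁻¹) / 2 := by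
  funext i
  simp only [hexPole, hexPeriodPair]
  ring

theorem hexPole_injective : Function.Injective hexPole := by
  intro i j h
  simp only [hexPole_eq_lattice_sub, ← hexPeriodPair.latticeEquiv_symm_apply] at h
  exact hexPeriodPair.latticeEquivProd.symm.injective (Subtype.ext (sub_left_injective h))

theorem norm_hexPole_sq (i : ℤ × ℤ) :
    ‖hexPole i‖ ^ 2 = (3 * (i.1 + i.2 - 1) ^ 2 + (i.1 - i.2) ^ 2 : ℤ) / 4 := by
  have hpole : hexPole i = ⟨(i.1 + i.2 - 1) * (√3 / 2), (i.1 - i.2) / 2⟩ := by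
    rw [hexPole, hexZeta_inv_eq_conj, hexZeta_eq]
    apply Complex.ext <;> simp <;> ring
  rw [hpole, Complex.sq_norm, normSq_mk]
  push_cast
  linear_combination ((i.1 + i.2 - 1 : ℝ) ^ 2 / 4) * Real.sq_sqrt (zero_le_three (α := ℝ))

theorem half_le_norm_hexPole (i : ℤ × ℤ) : 1 / 2 ≤ ‖hexPole i‖ := by
  have hint : 0 < 3 * (i.1 + i.2 - 1) ^ 2 + (i.1 - i.2) ^ 2 := by
    rcases eq_or_ne i.1 i.2 with h | h
    · have : i.1 + i.2 - 1 ≠ 0 := by omega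
      positivity
    · have := sub_ne_zero.2 h
      positivity
  have hcast : (1 : ℝ) ≤ (3 * (i.1 + i.2 - 1) ^ 2 + (i.1 - i.2) ^ 2 : ℤ) := by exact_mod_cast hint
  refine le_of_sq_le_sq ?_ (norm_nonneg _)
  rw [norm_hexPole_sq]
  linarith

theorem notMem_range_hexPole_of_norm_lt {z : ℂ} (hz : ‖z‖ < 1 / 2) : z ∉ Set.range hexPole := by
  rintro ⟨i, rfl⟩
  exact (half_le_norm_hexPole i).not_gt hz

theorem hexChar_eq (i : ℤ × ℤ) : hexChar i = hexOmega ^ (2 * i.1 + i.2) := by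
  rw [hexChar, hexOmega, ← zpow_natCast, ← zpow_mul]
  congr 1
  push_cast
  ring

theorem norm_hexChar (i : ℤ × ℤ) : ‖hexChar i‖ = 1 := by
  rw [hexChar, norm_zpow, norm_hexZeta, one_zpow]

theorem isMittagLefflerFamily_hex : IsMittagLefflerFamily hexChar hexPole :=
  hexPole_eq_lattice_sub ▸
    isMittagLefflerFamily_lattice_sub hexPeriodPair (fun i => (norm_hexChar i).le) _

theorem summable_hexTerm {n : ℕ} (hn : 2 ≤ n) :
    Summable fun i : ℤ × ℤ => hexTerm n i.1 i.2 := by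
  refine .of_norm ((summable_norm_lattice_sub_inv_pow hexPeriodPair
    (by omega : 2 < n + 1) ((hexZeta + hexZeta⁻¹) / 2)).congr fun i => ?_)
  rw [← congrFun hexPole_eq_lattice_sub i]
  change _ = ‖hexChar i / hexPole i ^ (n + 1)‖
  rw [norm_div, norm_hexChar, norm_pow, one_div, inv_pow]

theorem hexPole_add (i j : ℤ × ℤ) :
    hexPole (i + j) = hexPole i + (j.1 * hexZeta + j.2 * hexZeta⁻¹) := by
  simp only [hexPole, Prod.fst_add, Prod.snd_add]
  push_cast
  ring

theorem hexChar_add (i j : ℤ × ℤ) :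
    hexChar (i + j) = hexOmega ^ (2 * j.1 + j.2) * hexChar i := by
  rw [hexChar_eq, hexChar_eq, ← zpow_add₀ hexOmega_ne_zero]
  congr 1
  simp only [Prod.fst_add, Prod.snd_add]
  ring

theorem hexPole_one_sub (i : ℤ × ℤ) : hexPole (1 - i) = -hexPole i := by
  simp only [hexPole, Prod.fst_sub, Prod.snd_sub, Prod.fst_one, Prod.snd_one]
  push_cast
  ring

theorem neg_notMem_range_hexPole {z : ℂ} (hz : z ∉ Set.range hexPole) :
    -z ∉ Set.range hexPole := by
  rintro ⟨i, hi⟩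
  exact hz ⟨1 - i, by rw [hexPole_one_sub, hi, neg_neg]⟩

theorem hexChar_one_sub_sq (i : ℤ × ℤ) : hexChar (1 - i) ^ 2 = hexChar i := by
  rw [hexChar_eq, hexChar_eq, ← zpow_natCast, ← zpow_mul]
  refine hexOmega_zpow_eq_of_modEq (Int.modEq_iff_dvd.2 ⟨2 * i.1 + i.2 - 2, ?_⟩)
  simp only [Prod.fst_sub, Prod.snd_sub, Prod.fst_one, Prod.snd_one]
  push_cast
  ring

theorem conj_hexPole (i : ℤ × ℤ) : conj (hexPole i) = hexPole i.swap := by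
  simp only [hexPole, map_add, map_mul, map_sub, ← hexZeta_inv_eq_conj, Prod.fst_swap,
    Prod.snd_swap, map_inv₀, inv_inv, map_div₀, map_one, map_intCast, conj_ofNat]
  ring

theorem conj_hexChar (i : ℤ × ℤ) : conj (hexChar i) = hexChar i.swap := by
  rw [hexChar_eq, hexChar_eq, map_zpow₀, conj_hexOmega, ← zpow_natCast, ← zpow_mul]
  refine hexOmega_zpow_eq_of_modEq (Int.modEq_iff_dvd.2 ⟨-i.1, ?_⟩)
  simp only [Prod.fst_swap, Prod.snd_swap]
  push_cast
  ring

/-- The permutation of the indices induced by the rotation of the poles by `ω` about the pole of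
index `j`. -/
def hexRotation (j : ℤ × ℤ) : Equiv.Perm (ℤ × ℤ) where
  toFun i := (j.1 - j.2 + i.2, 2 * j.2 + j.1 - i.1 - i.2)
  invFun i := (j.2 + 2 * j.1 - i.2 - i.1, i.1 - j.1 + j.2)
  left_inv i := by ext <;> simp <;> ring
  right_inv i := by ext <;> simp; ring

theorem hexPole_hexRotation (j i : ℤ × ℤ) :
    hexPole (hexRotation j i) = hexOmega * hexPole i + (hexPole j - hexOmega * hexPole j) := by
  simp only [hexRotation, Equiv.coe_fn_mk, hexPole]
  push_cast
  linear_combination (j.1 - i.1 : ℂ) * hexOmega_mul_zeta +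
    (j.2 - i.2 : ℂ) * hexOmega_mul_zeta_inv

theorem hexChar_hexRotation (j i : ℤ × ℤ) : hexChar (hexRotation j i) = hexChar i := by
  rw [hexChar_eq, hexChar_eq]
  refine hexOmega_zpow_eq_of_modEq (Int.modEq_iff_dvd.2 ⟨i.1 - j.1, ?_⟩)
  simp only [hexRotation, Equiv.coe_fn_mk]
  ring

theorem compl_range_hexPole_mem_nhds_zero : (Set.range hexPole)ᶜ ∈ 𝓝 0 :=
  mem_of_superset (ball_mem_nhds 0 one_half_pos) fun _ hz =>
    notMem_range_hexPole_of_norm_lt (mem_ball_zero_iff.1 hz)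

/-! ### The quasi-periodic function of the hexagonal lattice -/

theorem exists_hexFun : ∃ f : ℂ → ℂ,
    IsAffineFunction (fun z => f z - mittagLefflerSum hexChar hexPole z) ∧
      ∀ z, f (z + hexZeta) = hexOmega ^ 2 * f z := by
  refine exists_quasiperiodic_of_isAffineFunction hexOmega_sq_ne_one ?_
  simpa only [one_mul] using isMittagLefflerFamily_hex.isAffineFunction_symmetry
    (σ := Equiv.addRight (1, 0)) (α := 1) (β := hexZeta) (v := hexOmega ^ 2) one_ne_zero
    (fun i => by simp [hexPole_add])
    (fun i => by rw [Equiv.coe_addRight, hexChar_add]; norm_cast)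

/-- The meromorphic function with a simple pole of residue `hexChar i` at each `hexPole i`, the
affine ambiguity of its Mittag-Leffler sum being fixed by quasi-periodicity. Its Taylor coefficients
at the origin are both the lattice sums and multiples of the pseudo-factorials. -/
noncomputable def hexFun : ℂ → ℂ := exists_hexFun.choose

theorem isAffineFunction_hexFun_sub :
    IsAffineFunction fun z => hexFun z - mittagLefflerSum hexChar hexPole z :=
  exists_hexFun.choose_spec.1

theorem hexFun_add_zeta (z : ℂ) : hexFun (z + hexZeta) = hexOmega ^ 2 * hexFun z :=
  exists_hexFun.choose_spec.2 z

theorem hexFun_symmetry {σ : Equiv.Perm (ℤ × ℤ)} {α β v : ℂ} (hα : α ≠ 0)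
    (hp : ∀ i, hexPole (σ i) = α * hexPole i + β) (hc : ∀ i, hexChar (σ i) = v * hexChar i)
    (hαβ : ∀ z, hexFun (α * (z + hexZeta) + β) = hexOmega ^ 2 * hexFun (α * z + β)) (z : ℂ) :
    α * hexFun (α * z + β) = v * hexFun z :=
  eq_of_isAffineFunction_symmetry hexOmega_sq_ne_one isAffineFunction_hexFun_sub hexFun_add_zeta
    (isMittagLefflerFamily_hex.isAffineFunction_symmetry hα hp hc) hαβ z

theorem hexFun_add_zeta_inv (z : ℂ) : hexFun (z + hexZeta⁻¹) = hexOmega * hexFun z := by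
  simpa only [one_mul] using hexFun_symmetry (σ := Equiv.addRight (0, 1)) (α := 1)
    (β := hexZeta⁻¹) (v := hexOmega) one_ne_zero
    (fun i => by simp [hexPole_add])
    (fun i => by simp [hexChar_add])
    (fun z => by rw [one_mul, one_mul, add_right_comm, hexFun_add_zeta]) z

theorem hexFun_sub_zeta (z : ℂ) : hexFun (z - hexZeta) = hexOmega * hexFun z := by
  have := hexFun_add_zeta (z - hexZeta)
  rw [sub_add_cancel] at this
  linear_combination -hexOmega * this - hexFun (z - hexZeta) * hexOmega_pow_three

theorem hexFun_sub_zeta_inv (z : ℂ) : hexFun (z - hexZeta⁻¹) = hexOmega ^ 2 * hexFun z := by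
  have := hexFun_add_zeta_inv (z - hexZeta⁻¹)
  rw [sub_add_cancel] at this
  linear_combination -hexOmega ^ 2 * this - hexFun (z - hexZeta⁻¹) * hexOmega_pow_three

theorem hexFun_rotation (j : ℤ × ℤ) (z : ℂ) :
    hexOmega * hexFun (hexOmega * z + (hexPole j - hexOmega * hexPole j)) = hexFun z := by
  rw [hexFun_symmetry (v := 1) hexOmega_ne_zero (hexPole_hexRotation j)
    (fun i => by rw [hexChar_hexRotation, one_mul]) (fun z => ?_), one_mul]
  rw [← hexFun_sub_zeta_inv]
  congr 1
  linear_combination hexOmega_mul_zeta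

theorem conj_hexFun (z : ℂ) : conj (hexFun (conj z)) = hexFun z := by
  refine congrFun (eq_of_quasiperiodic_of_isAffineFunction_sub (l := hexZeta)
    (f := fun z => conj (hexFun (conj z))) hexOmega_sq_ne_one (fun z => ?_) hexFun_add_zeta ?_) z
  · rw [map_add, ← hexZeta_inv_eq_conj, hexFun_add_zeta_inv, map_mul, conj_hexOmega]
  · obtain ⟨a, b, hab⟩ := isAffineFunction_hexFun_sub
    have hconj := conj_mittagLefflerSum (σ := Equiv.prodComm ℤ ℤ)
      (fun i => (conj_hexPole i).symm) (fun i => (conj_hexChar i).symm)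
    refine ⟨conj a - a, conj b - b, fun z => ?_⟩
    beta_reduce
    rw [eq_add_of_sub_eq (hab z), eq_add_of_sub_eq (hab (conj z))]
    simp only [map_add, map_mul, conj_conj, hconj]
    ring

theorem im_hexFun_ofReal (x : ℝ) : (hexFun x).im = 0 :=
  conj_eq_iff_im.1 (by simpa only [conj_ofReal] using conj_hexFun x)

theorem analyticAt_hexFun {z : ℂ} (hz : z ∉ Set.range hexPole) : AnalyticAt ℂ hexFun z := by
  simpa only [Pi.add_def, sub_add_cancel] using
    (isAffineFunction_hexFun_sub.analyticAt z).add (isMittagLefflerFamily_hex.analyticAt hz)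

theorem hexFun_hexPole (i : ℤ × ℤ) : hexFun (hexPole i) = 0 := by
  have h := hexFun_rotation i (hexPole i)
  rw [add_sub_cancel] at h
  exact by_contra fun h0 => hexOmega_ne_one ((mul_eq_right₀ h0).1 h)

theorem hexFun_eq_div_add (i : ℤ × ℤ) : ∃ r : ℂ → ℂ, AnalyticAt ℂ r (hexPole i) ∧
    r (hexPole i) = 0 ∧ ∀ z, hexFun z = hexChar i / (z - hexPole i) + r z := by
  obtain ⟨r, hr, h⟩ := isMittagLefflerFamily_hex.exists_eq_div_add hexPole_injective i
  have hf (z : ℂ) : hexFun z = hexChar i / (z - hexPole i) +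
      (r z + (hexFun z - mittagLefflerSum hexChar hexPole z)) := by
    linear_combination h z
  refine ⟨_, hr.add (isAffineFunction_hexFun_sub.analyticAt _), ?_, hf⟩
  -- The junk value `c / 0 = 0` makes the value of `hexFun` at a pole that of its regular part.
  simpa [hexFun_hexPole] using (hf (hexPole i)).symm

theorem meromorphic_hexFun : Meromorphic hexFun := by
  intro z
  by_cases hz : z ∈ Set.range hexPole
  · obtain ⟨i, rfl⟩ := hz
    obtain ⟨r, hr, -, h⟩ := hexFun_eq_div_add i
    exact meromorphicAt_of_eq_div_add hr h
  · exact (analyticAt_hexFun hz).meromorphicAt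

theorem analyticAt_deriv_hexFun_add_sq {z : ℂ} (hz : z ∉ Set.range hexPole) :
    AnalyticAt ℂ (fun z => deriv hexFun z + hexFun (-z) ^ 2) z :=
  (analyticAt_hexFun hz).deriv.fun_add
    (((analyticAt_hexFun (neg_notMem_range_hexPole hz)).fun_comp analyticAt_id.fun_neg).fun_pow 2)

theorem deriv_hexFun_add_sq_removable (z₀ : ℂ) : ∃ k : ℂ → ℂ, AnalyticAt ℂ k z₀ ∧
    (fun z => deriv hexFun z + hexFun (-z) ^ 2) =ᶠ[𝓝[≠] z₀] k := by
  by_cases hz : z₀ ∈ Set.range hexPole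
  · obtain ⟨i, rfl⟩ := hz
    obtain ⟨r, hr, -, h⟩ := hexFun_eq_div_add i
    obtain ⟨s, hs, hs0, h'⟩ := hexFun_eq_div_add (1 - i)
    rw [hexPole_one_sub] at hs hs0 h'
    refine deriv_add_sq_removable (b := -hexChar (1 - i)) (s := fun z => s (-z)) hr
      (hs.fun_comp analyticAt_id.fun_neg) h (fun z => ?_) (by rw [neg_sq, hexChar_one_sub_sq]) hs0
    rw [h', neg_sub_neg, ← neg_sub z, div_neg, neg_div]
  · exact ⟨_, analyticAt_deriv_hexFun_add_sq hz, EventuallyEq.rfl⟩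

theorem solvesReflectedRiccati_hexFun :
    SolvesReflectedRiccati hexFun (Set.range hexPole)ᶜ := by
  intro z hz
  have hzero := eventuallyEq_zero_of_quasiperiodic_of_removable hexPeriodPair
    (H := fun z => deriv hexFun z + hexFun (-z) ^ 2) (u₁ := hexOmega ^ 2) (u₂ := hexOmega)
    (fun z => ?_) (fun z => ?_) (by rw [norm_pow, norm_hexOmega, one_pow]) norm_hexOmega
    hexOmega_sq_ne_one deriv_hexFun_add_sq_removable z
  · have hHz := ((ContinuousAt.eventuallyEq_nhds_iff_eventuallyEq_nhdsNE
      (analyticAt_deriv_hexFun_add_sq hz).continuousAt continuousAt_const).1 hzero).eq_of_nhds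
    exact (analyticAt_hexFun hz).differentiableAt.hasDerivAt.congr_deriv
      (eq_neg_of_add_eq_zero_left hHz)
  · change deriv hexFun (z + hexZeta) + hexFun (-(z + hexZeta)) ^ 2 = _
    rw [deriv_add_const_of_quasiperiodic hexFun_add_zeta, neg_add, ← sub_eq_add_neg,
      hexFun_sub_zeta, smul_eq_mul]
    ring
  · change deriv hexFun (z + hexZeta⁻¹) + hexFun (-(z + hexZeta⁻¹)) ^ 2 = _
    rw [deriv_add_const_of_quasiperiodic hexFun_add_zeta_inv, neg_add, ← sub_eq_add_neg,
      hexFun_sub_zeta_inv, smul_eq_mul]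
    linear_combination hexOmega * hexFun (-z) ^ 2 * hexOmega_pow_three

theorem analyticAt_hexFun_zero : AnalyticAt ℂ hexFun 0 :=
  analyticAt_hexFun (mem_of_mem_nhds compl_range_hexPole_mem_nhds_zero)

theorem hexFun_zero_ne_zero : hexFun 0 ≠ 0 := by
  obtain ⟨r, hr, -, h⟩ := hexFun_eq_div_add 0
  have hres : hexChar 0 ≠ 0 := norm_ne_zero_iff.1 (by simp [norm_hexChar])
  exact solvesReflectedRiccati_hexFun.apply_zero_ne_zero compl_range_hexPole_mem_nhds_zero
    meromorphic_hexFun (meromorphicOrderAt_ne_top_of_eq_div_add hres hr h)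

theorem hexFun_zeta_add_inv_div_six : hexFun ((hexZeta + hexZeta⁻¹) / 6) = 0 := by
  set c := (hexZeta + hexZeta⁻¹) / 6 with hc
  -- Up to a period, the rotation by `ω` about a pole fixes `c`.
  have hfix : hexOmega * c + (hexPole 0 - hexOmega * hexPole 0) =
      c - hexZeta⁻¹ - hexZeta⁻¹ := by
    rw [hc, hexPole, Prod.fst_zero, Prod.snd_zero, Int.cast_zero]
    linear_combination (2 / 3 : ℂ) * hexOmega_mul_zeta + (2 / 3 : ℂ) * hexOmega_mul_zeta_inv
  have hrot := hexFun_rotation 0 c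
  rw [hfix, hexFun_sub_zeta_inv, hexFun_sub_zeta_inv] at hrot
  have hmul : hexOmega ^ 2 * hexFun c = hexFun c := by
    linear_combination hrot - hexOmega ^ 2 * hexFun c * hexOmega_pow_three
  exact by_contra fun h0 => hexOmega_sq_ne_one ((mul_eq_right₀ h0).1 hmul)

theorem hexFun_sqrt_three_div_six : hexFun (√3 / 6 : ℝ) = 0 := by
  rw [ofReal_div, ← hexZeta_add_inv, ofReal_ofNat, hexFun_zeta_add_inv_div_six]

theorem solvesReflectedRiccati_re_hexFun :
    SolvesReflectedRiccati (fun x : ℝ => (hexFun x).re) (Set.Icc (-(√3 / 6)) (√3 / 6)) := by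
  have hlt : √3 < 3 := by rw [Real.sqrt_lt' three_pos]; norm_num
  refine solvesReflectedRiccati_hexFun.re_comp_ofReal im_hexFun_ofReal fun x hx =>
    notMem_range_hexPole_of_norm_lt ?_
  rw [norm_real, Real.norm_eq_abs]
  exact (abs_le.2 hx).trans_lt (by linarith)

theorem hexRho_eq_of_piThree_eq {g : ℝ} (h : piThree = (2 : ℝ) ^ (1 / 3 : ℝ) * g * √3) :
    hexRho = g := by
  have hpow : (2 : ℝ) ^ (1 / 3 : ℝ) * (2 : ℝ) ^ (-(1 / 3) : ℝ) = 1 := by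
    rw [← Real.rpow_add two_pos, add_neg_cancel, Real.rpow_zero]
  have hsq : √3 * √3 = 3 := Real.mul_self_sqrt zero_le_three
  rw [hexRho, hexR, h]
  linear_combination (√3 * √3 * g / 3) * hpow + g / 3 * hsq

theorem hexFun_zero : hexFun 0 = hexRho := by
  have hreal : hexFun 0 = ((hexFun (0 : ℝ)).re : ℝ) := by
    rw [conj_eq_iff_re.1 (conj_eq_iff_im.2 (im_hexFun_ofReal 0)), ofReal_zero]
  have hre : (hexFun (0 : ℝ)).re ≠ 0 := fun h =>
    hexFun_zero_ne_zero (by rw [hreal, h, ofReal_zero])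
  have hpi := solvesReflectedRiccati_re_hexFun.piThree_eq (by positivity)
    (by rw [hexFun_sqrt_three_div_six, zero_re]) hre
  rw [mul_div_cancel₀ _ (by norm_num : (6 : ℝ) ≠ 0)] at hpi
  rw [hreal, hexRho_eq_of_piThree_eq hpi]

theorem iteratedDeriv_hexFun_zero {n : ℕ} (hn : 2 ≤ n) :
    iteratedDeriv n hexFun 0 = -(n.factorial * ∑' i : ℤ × ℤ, hexTerm n i.1 i.2) := by
  have hS : AnalyticAt ℂ (mittagLefflerSum hexChar hexPole) 0 :=
    isMittagLefflerFamily_hex.analyticAt (mem_of_mem_nhds compl_range_hexPole_mem_nhds_zero)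
  have haff := congrFun (isAffineFunction_hexFun_sub.iteratedDeriv_eq_zero hn) 0
  rw [iteratedDeriv_fun_sub analyticAt_hexFun_zero.contDiffAt hS.contDiffAt, Pi.zero_apply,
    sub_eq_zero] at haff
  exact haff.trans
    (isMittagLefflerFamily_hex.iteratedDeriv_mittagLefflerSum_zero one_half_pos
      half_le_norm_hexPole hn)

theorem theorem3 (n : ℕ) (hn : 2 ≤ n) :
    Summable (fun p : ℤ × ℤ => hexTerm n p.1 p.2) ∧
      (pseudoFactorial n : ℂ) =
        -((n.factorial : ℂ) / (hexRho : ℂ) ^ (n + 1)) *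
          ∑' p : ℤ × ℤ, hexTerm n p.1 p.2 := by
  refine ⟨summable_hexTerm hn, ?_⟩
  have hTaylor := solvesReflectedRiccati_hexFun.iteratedDeriv_zero
    compl_range_hexPole_mem_nhds_zero analyticAt_hexFun_zero.contDiffAt n
  rw [iteratedDeriv_hexFun_zero hn, hexFun_zero] at hTaylor
  have hρ : (hexRho : ℂ) ≠ 0 := hexFun_zero ▸ hexFun_zero_ne_zero
  field_simp
  linear_combination -hTaylor
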